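/- Let $\varphi:\mathbb C\to\mathbb C$ be a continuous function such that $\psi(t)=|\varphi(e^{it})|^2$ belongs to the class $\Phi$ of continuous non-negative $2\pi$-periodic functions on $\mathbb R$ with nowhere dense zero set and $\psi(0)=0$. Put $\mathcal I(\psi)=\frac1{2\pi}\int_0^{2\pi}\psi(t)\,dt$. A normalized weight is a non-negative integrable function $V$ on $[0,1]$ that is non-zero almost everywhere and satisfies $\int_0^1V=1$. Given a resolution of the identity $E$ on the Borel sets of $\mathbb R$ in a complex Hilbert space $H$ (a strongly countably additive map from Borel sets to orthogonal projections with $E(\emptyset)=0$, $E(\mathbb R)=I$), put, for $x\in H$, $\delta>0$, $\sigma>0$, $$\Delta^\varphi_tx=\int_{-\infty}^{\infty}\varphi(e^{its})\,dE(s)x,\qquad \omega_\varphi(x;\delta)=\max_{0\le t\le\delta}\|\Delta_t^\varphi x\|,$$ $$\omega_\varphi(x;L_{p,V}([0,\delta]))=\Bigl(\frac1\delta\int_0^\delta\|\Delta_t^\varphi x\|^p\,V\bigl(\tfrac t\delta\bigr)dt\Bigr)^{1/p}\ (1\le p<\infty),\qquad \omega_\varphi(x;L_{\infty,V}([0,\delta]))=\omega_\varphi(x;\delta),$$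 $$W_\sigma=\Bigl\{\int_{|t|<\sigma}dE(t)g:\ g\in H\Bigr\},\qquad E_\sigma(x)=\inf_{h\in W_\sigma}\|x-h\|.$$ **Theorem.** For every such $\varphi$ there are a point $\gamma>0$ and a normalized weight $\widetilde V$, depending only on $\varphi$, with $$\inf_{|t|\ge\sigma}\int_0^1\psi\bigl(\tfrac{\gamma}{\sigma}ts\bigr)\widetilde V(s)\,ds\ \ge\ \mathcal I(\psi)\qquad\text{for all }\sigma>0,$$ such that for every complex Hilbert space $H$ with a resolution of the identity $E$ as above, every $x\in H$ and every $\sigma>0$, $$E_\sigma(x)\le\frac1{\sqrt{\mathcal I(\psi)}}\,\omega_\varphi\bigl(x;L_{p,\widetilde V}([0,\gamma/\sigma])\bigr)\quad\text{for all }2\le p\le\infty .$$ In particular, $E_\sigma(x)\le\frac1{\sqrt{\mathcal I(\psi)}}\,\omega_\varphi(x;\gamma/\sigma)$. -/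

import Mathlib

open MeasureTheory Set Filter Topology
open scoped ENNReal NNReal

namespace JacksonStechkin

/-- A resolution of the identity in the complex Hilbert space `H`, on the Borel sets of the
real line: every Borel set `β` is sent to an orthogonal projection `proj β`, with
`proj ∅ = 0`, `proj ℝ = I` and strong countable additivity.
(The values of `proj` on sets that are not Borel are irrelevant.) -/
structure ResolutionOfIdentity (H : Type*) [NormedAddCommGroup H] [InnerProductSpace ℂ H]
    [CompleteSpace H] where
  proj : Set ℝ → H →L[ℂ] H
  isStarProjection : ∀ β : Set ℝ, MeasurableSet β → IsStarProjection (proj β)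
  proj_empty : proj ∅ = 0
  proj_univ : proj univ = 1
  hasSum_iUnion : ∀ β : ℕ → Set ℝ, (∀ j, MeasurableSet (β j)) →
    Pairwise (fun i j => Disjoint (β i) (β j)) →
    ∀ x : H, HasSum (fun j => proj (β j) x) (proj (⋃ j, β j) x)

section Spectral

variable {H : Type*} [NormedAddCommGroup H] [InnerProductSpace ℂ H] [CompleteSpace H]

theorem ResolutionOfIdentity.inner_proj (E : ResolutionOfIdentity H) {β : Set ℝ}
    (hβ : MeasurableSet β) (x : H) :
    inner ℂ x (E.proj β x) = ((‖E.proj β x‖ ^ 2 : ℝ) : ℂ) := by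
  have h := E.isStarProjection β hβ
  have h1 : E.proj β (E.proj β x) = E.proj β x := by
    have := congrArg (fun T : H →L[ℂ] H => T x) h.isIdempotentElem.eq
    simpa using this
  have h2 : ContinuousLinearMap.adjoint (E.proj β) = E.proj β := h.isSelfAdjoint
  calc inner ℂ x (E.proj β x) = inner ℂ x (E.proj β (E.proj β x)) := by rw [h1]
    _ = inner ℂ (ContinuousLinearMap.adjoint (E.proj β) x) (E.proj β x) := by
        rw [ContinuousLinearMap.adjoint_inner_left]
    _ = inner ℂ (E.proj β x) (E.proj β x) := by rw [h2]
    _ = ((‖E.proj β x‖ ^ 2 : ℝ) : ℂ) := by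
        rw [inner_self_eq_norm_sq_to_K]; push_cast; rfl

theorem ResolutionOfIdentity.hasSum_norm_sq (E : ResolutionOfIdentity H) (β : ℕ → Set ℝ)
    (hβ : ∀ j, MeasurableSet (β j)) (hd : Pairwise (fun i j => Disjoint (β i) (β j))) (x : H) :
    HasSum (fun j => ‖E.proj (β j) x‖ ^ 2) (‖E.proj (⋃ j, β j) x‖ ^ 2) := by
  have h := (innerSL ℂ x).hasSum (E.hasSum_iUnion β hβ hd x)
  simp only [innerSL_apply_apply] at h
  rw [E.inner_proj (MeasurableSet.iUnion hβ)] at h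
  have h' : (fun j => inner ℂ x (E.proj (β j) x))
      = fun j => ((‖E.proj (β j) x‖ ^ 2 : ℝ) : ℂ) := by
    funext j
    exact E.inner_proj (hβ j) x
  have h3 : HasSum (fun j => ((‖E.proj (β j) x‖ ^ 2 : ℝ) : ℂ))
      ((‖E.proj (⋃ j, β j) x‖ ^ 2 : ℝ) : ℂ) := by
    rw [← h']; exact h
  exact Complex.hasSum_ofReal.mp h3

/-- The measure `β ↦ (E(β)x, x) = ‖E(β)x‖²`. -/
noncomputable def ResolutionOfIdentity.measure (E : ResolutionOfIdentity H) (x : H) :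
    Measure ℝ :=
  Measure.ofMeasurable (fun β _ => ENNReal.ofReal (‖E.proj β x‖ ^ 2))
    (by simp [E.proj_empty])
    (by
      intro β hβ hd
      have h := E.hasSum_norm_sq β hβ hd x
      rw [← h.tsum_eq]
      exact ENNReal.ofReal_tsum_of_nonneg (fun _ => by positivity) h.summable)

theorem ResolutionOfIdentity.measure_apply (E : ResolutionOfIdentity H) (x : H) {β : Set ℝ}
    (hβ : MeasurableSet β) : E.measure x β = ENNReal.ofReal (‖E.proj β x‖ ^ 2) :=
  Measure.ofMeasurable_apply β hβ

instance (E : ResolutionOfIdentity H) (x : H) : IsFiniteMeasure (E.measure x) :=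
  ⟨by rw [E.measure_apply x MeasurableSet.univ]; exact ENNReal.ofReal_lt_top⟩

theorem ResolutionOfIdentity.measureReal_univ (E : ResolutionOfIdentity H) (x : H) :
    (E.measure x).real univ = ‖x‖ ^ 2 := by
  rw [measureReal_def, E.measure_apply x MeasurableSet.univ, E.proj_univ,
    ENNReal.toReal_ofReal (by positivity)]
  simp

/-- `T = ∫ F(s) dE(s)`, i.e. `(T x, x) = ∫ F(s) d(E(s)x, x)` for all `x`. -/
def IsSpectralIntegral (E : ResolutionOfIdentity H) (F : ℝ → ℂ) (T : H →L[ℂ] H) : Prop :=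
  ∀ x : H, inner ℂ x (T x) = ∫ s, F s ∂(E.measure x)

theorem IsSpectralIntegral.unique {E : ResolutionOfIdentity H} {F : ℝ → ℂ} {S T : H →L[ℂ] H}
    (hS : IsSpectralIntegral E F S) (hT : IsSpectralIntegral E F T) : S = T := by
  have h : (S : H →ₗ[ℂ] H) = T := by
    rw [← ext_inner_map]
    intro x
    have := (hS x).trans (hT x).symm
    have h2 := congrArg (starRingEnd ℂ) this
    simpa only [inner_conj_symm, ContinuousLinearMap.coe_coe] using h2
  exact ContinuousLinearMap.coe_injective h

theorem norm_le_of_quadratic {K : Type*} [NormedAddCommGroup K] [InnerProductSpace ℂ K]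
    (T : K →L[ℂ] K) {C : ℝ} (hC : 0 ≤ C)
    (h : ∀ x : K, ‖inner ℂ x (T x)‖ ≤ C * ‖x‖ ^ 2) : ‖T‖ ≤ 2 * C := by
  have h' : ∀ x : K, ‖inner ℂ (T x) x‖ ≤ C * ‖x‖ ^ 2 := by
    intro x
    rw [norm_inner_symm]
    exact h x
  have key : ∀ x y : K, ‖inner ℂ (T y) x‖ ≤ C * (‖x‖ ^ 2 + ‖y‖ ^ 2) := by
    intro x y
    have hp := inner_map_polarization (T : K →ₗ[ℂ] K) x y
    simp only [ContinuousLinearMap.coe_coe] at hp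
    rw [hp, norm_div]
    have e1 := parallelogram_law_with_norm ℂ x y
    have e2 := parallelogram_law_with_norm ℂ x (Complex.I • y)
    have e3 : ‖Complex.I • y‖ = ‖y‖ := by simp [norm_smul]
    rw [e3] at e2
    have b1 := h' (x + y)
    have b2 := h' (x - y)
    have b3 := h' (x + Complex.I • y)
    have b4 := h' (x - Complex.I • y)
    have n4 : ‖(4 : ℂ)‖ = 4 := by norm_num
    rw [n4, div_le_iff₀ (by norm_num)]
    refine (norm_sub_le _ _).trans ?_
    refine (add_le_add_left (norm_add_le _ _) _).trans ?_
    refine (add_le_add_left (add_le_add_left (norm_sub_le _ _) _) _).trans ?_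
    rw [norm_mul, norm_mul, Complex.norm_I, one_mul, one_mul]
    nlinarith
  refine ContinuousLinearMap.opNorm_le_of_unit_norm (by positivity) fun x hx => ?_
  by_cases hT : T x = 0
  · rw [hT, norm_zero]; positivity
  have hpos : 0 < ‖T x‖ := norm_pos_iff.mpr hT
  have k := key (((‖T x‖⁻¹ : ℝ) : ℂ) • T x) x
  rw [inner_smul_right, inner_self_eq_norm_sq_to_K, norm_mul, norm_smul, hx] at k
  simp only [Complex.norm_real, norm_inv, norm_norm, norm_pow, Complex.coe_algebraMap] at k
  rw [inv_mul_cancel₀ hpos.ne', pow_two, ← mul_assoc, inv_mul_cancel₀ hpos.ne'] at k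
  linarith

theorem isSpectralIntegral_simpleFunc (E : ResolutionOfIdentity H) (f : SimpleFunc ℝ ℂ) :
    IsSpectralIntegral E f (∑ c ∈ f.range, c • E.proj (f ⁻¹' {c})) := by
  intro x
  have hint : Integrable (f : ℝ → ℂ) (E.measure x) :=
    SimpleFunc.integrable_of_isFiniteMeasure f
  rw [← SimpleFunc.integral_eq_integral f hint, SimpleFunc.integral_eq]
  rw [sum_apply, inner_sum]
  refine Finset.sum_congr rfl fun c _ => ?_
  have hm : MeasurableSet (f ⁻¹' {c}) := f.measurableSet_preimage _
  rw [smul_apply, inner_smul_right, E.inner_proj hm, measureReal_def,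
    E.measure_apply x hm, ENNReal.toReal_ofReal (by positivity), mul_comm]
  simp

theorem exists_simpleFunc_near {F : ℝ → ℂ} (hF : Measurable F) {M : ℝ}
    (hM : ∀ s, ‖F s‖ ≤ M) {ε : ℝ} (hε : 0 < ε) :
    ∃ f : SimpleFunc ℝ ℂ, ∀ s, ‖f s - F s‖ ≤ ε := by
  let e : ℕ → ℂ := TopologicalSpace.denseSeq ℂ
  let U : ℕ → Set ℂ := fun N => ⋃ k ∈ Set.Iic N, Metric.ball (e k) ε
  obtain ⟨N, hN⟩ := (isCompact_closedBall (0 : ℂ) M).elim_directed_cover U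
    (fun N => isOpen_biUnion fun _ _ => Metric.isOpen_ball)
    (by
      intro z _
      obtain ⟨k, hk⟩ := (TopologicalSpace.denseRange_denseSeq ℂ).exists_dist_lt z hε
      exact mem_iUnion.mpr ⟨k, mem_biUnion (mem_Iic.mpr le_rfl) (Metric.mem_ball.mpr hk)⟩)
    (directed_of_isDirected_le fun i j hij =>
      biUnion_subset_biUnion_left (Iic_subset_Iic.mpr hij))
  refine ⟨(SimpleFunc.nearestPt e N).comp F hF, fun s => ?_⟩
  have hs : F s ∈ Metric.closedBall (0 : ℂ) M := by simpa using hM s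
  obtain ⟨k, hk, hk2⟩ := mem_iUnion₂.mp (hN hs)
  have h1 := SimpleFunc.edist_nearestPt_le e (F s) (mem_Iic.mp hk)
  rw [edist_dist, edist_dist, ENNReal.ofReal_le_ofReal_iff dist_nonneg] at h1
  rw [SimpleFunc.coe_comp, Function.comp_apply, ← dist_eq_norm]
  exact h1.trans ((dist_comm _ _).trans_le (Metric.mem_ball.mp hk2).le)

theorem exists_isSpectralIntegral (E : ResolutionOfIdentity H) {F : ℝ → ℂ} (hF : Measurable F)
    {M : ℝ} (hM : ∀ s, ‖F s‖ ≤ M) : ∃ T : H →L[ℂ] H, IsSpectralIntegral E F T := by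
  have hpos : ∀ n : ℕ, (0 : ℝ) < 1 / ((n : ℝ) + 1) := fun n => Nat.one_div_pos_of_nat
  choose f hf using fun n : ℕ => exists_simpleFunc_near hF hM (hpos n)
  let T : ℕ → H →L[ℂ] H := fun n => ∑ c ∈ (f n).range, c • E.proj (f n ⁻¹' {c})
  have hT : ∀ n, IsSpectralIntegral E (f n) (T n) := fun n => isSpectralIntegral_simpleFunc E _
  have hint : ∀ n x, Integrable (f n : ℝ → ℂ) (E.measure x) := fun n x =>
    SimpleFunc.integrable_of_isFiniteMeasure _
  have hFint : ∀ x, Integrable F (E.measure x) := fun x =>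
    Integrable.of_bound hF.aestronglyMeasurable M (Eventually.of_forall hM)
  have hdist : ∀ n m, ‖T n - T m‖ ≤ 2 * (1 / ((n : ℝ) + 1) + 1 / ((m : ℝ) + 1)) := by
    intro n m
    refine norm_le_of_quadratic _ (add_pos (hpos n) (hpos m)).le fun x => ?_
    rw [sub_apply, inner_sub_right, hT n x, hT m x,
      ← integral_sub (hint n x) (hint m x)]
    refine (norm_integral_le_of_norm_le_const (C := 1 / ((n : ℝ) + 1) + 1 / ((m : ℝ) + 1))
      (Eventually.of_forall fun s => ?_)).trans_eq ?_
    · have h1 := hf n s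
      have h2 := hf m s
      rw [norm_sub_rev] at h2
      have h3 := norm_add_le (f n s - F s) (F s - f m s)
      rw [sub_add_sub_cancel] at h3
      linarith
    · rw [E.measureReal_univ]
  have hlim : Tendsto (fun n : ℕ => 1 / ((n : ℝ) + 1)) atTop (𝓝 0) :=
    tendsto_one_div_add_atTop_nhds_zero_nat
  have hc : CauchySeq T := by
    refine cauchySeq_of_le_tendsto_0' (fun n : ℕ => 4 * (1 / ((n : ℝ) + 1))) (fun n m hnm => ?_)
      (by simpa using hlim.const_mul 4)
    rw [dist_eq_norm]
    have : 1 / ((m : ℝ) + 1) ≤ 1 / ((n : ℝ) + 1) := Nat.one_div_le_one_div hnm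
    linarith [hdist n m]
  obtain ⟨L, hL⟩ := cauchySeq_tendsto_of_complete hc
  refine ⟨L, fun x => ?_⟩
  have h1 : Tendsto (fun n => inner ℂ x (T n x)) atTop (𝓝 (inner ℂ x (L x))) :=
    tendsto_const_nhds.inner (((ContinuousLinearMap.apply ℂ H x).continuous.tendsto L).comp hL)
  have h2 : Tendsto (fun n => ∫ s, f n s ∂(E.measure x)) atTop
      (𝓝 (∫ s, F s ∂(E.measure x))) := by
    rw [tendsto_iff_norm_sub_tendsto_zero]
    refine squeeze_zero (g := fun n : ℕ => 1 / ((n : ℝ) + 1) * ‖x‖ ^ 2)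
      (fun _ => norm_nonneg _) (fun n => ?_) (by simpa using hlim.mul_const (‖x‖ ^ 2))
    rw [← integral_sub (hint n x) (hFint x)]
    refine (norm_integral_le_of_norm_le_const (Eventually.of_forall (hf n))).trans_eq ?_
    rw [E.measureReal_univ]
  refine tendsto_nhds_unique h1 ?_
  simpa only [hT _ x] using h2

open Classical in
/-- The spectral integral `∫ F(s) dE(s)`, a bounded operator, for bounded Borel functions `F`. -/
noncomputable def spectralIntegral (E : ResolutionOfIdentity H) (F : ℝ → ℂ) : H →L[ℂ] H :=
  if h : ∃ T : H →L[ℂ] H, IsSpectralIntegral E F T then h.choose else 0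

theorem isSpectralIntegral_spectralIntegral (E : ResolutionOfIdentity H) {F : ℝ → ℂ}
    (hF : Measurable F) {M : ℝ} (hM : ∀ s, ‖F s‖ ≤ M) :
    IsSpectralIntegral E F (spectralIntegral E F) := by
  have h := exists_isSpectralIntegral E hF hM
  rw [spectralIntegral, dif_pos h]
  exact h.choose_spec

/-- The generalized difference `Δ_t^φ x = ∫ φ(e^{its}) dE(s) x`. -/
noncomputable def genDiff (φ : ℂ → ℂ) (E : ResolutionOfIdentity H) (t : ℝ) (x : H) : H :=
  spectralIntegral E (fun s : ℝ => φ (Complex.exp (Complex.I * (t : ℂ) * (s : ℂ)))) x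

/-- The generalized modulus of continuity
`ω_φ(x, δ) = ω_φ(x; C([0, δ])) = max_{0 ≤ t ≤ δ} ‖Δ_t^φ x‖`. -/
noncomputable def modulus (φ : ℂ → ℂ) (E : ResolutionOfIdentity H) (x : H) (δ : ℝ) : ℝ :=
  ⨆ t : Icc (0 : ℝ) δ, ‖genDiff φ E (t : ℝ) x‖

open Classical in
/-- `ω_φ(x; L_{p,V}([0, δ]))`: for `p < ∞` it is
`((1/δ) ∫_0^δ ‖Δ_t^φ x‖^p V(t/δ) dt)^{1/p}`, and for `p = ∞` it is `ω_φ(x, δ)`. -/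
noncomputable def modulusLp (φ : ℂ → ℂ) (E : ResolutionOfIdentity H) (x : H) (p : ℝ≥0∞)
    (V : ℝ → ℝ) (δ : ℝ) : ℝ :=
  if p = ∞ then modulus φ E x δ
  else (1 / δ * ∫ t in (0 : ℝ)..δ, ‖genDiff φ E t x‖ ^ p.toReal * V (t / δ)) ^ (1 / p.toReal)

/-- The subspace `W_σ = {∫_{|t| < σ} dE(t) g : g ∈ H}`, the range of `E({t : |t| < σ})`. -/
def bandSubspace (E : ResolutionOfIdentity H) (σ : ℝ) : Submodule ℂ H :=
  LinearMap.range (E.proj {t : ℝ | |t| < σ} : H →ₗ[ℂ] H)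

/-- The best approximation `E_σ(x) = inf_{h ∈ W_σ} ‖x - h‖`. -/
noncomputable def bestApprox (E : ResolutionOfIdentity H) (σ : ℝ) (x : H) : ℝ :=
  ⨅ h : bandSubspace E σ, ‖x - (h : H)‖

end Spectral

/-- The class `Φ`. -/
structure IsPhi (ψ : ℝ → ℝ) : Prop where
  continuous : Continuous ψ
  nonneg : ∀ t, 0 ≤ ψ t
  periodic : Function.Periodic ψ (2 * Real.pi)
  isNowhereDense_zeros : IsNowhereDense {t : ℝ | ψ t = 0}
  map_zero : ψ 0 = 0

/-- `ψ(t) = |φ(e^{it})|²`. -/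
noncomputable def psiOf (φ : ℂ → ℂ) (t : ℝ) : ℝ :=
  ‖φ (Complex.exp (Complex.I * (t : ℂ)))‖ ^ 2

/-- The mean value `𝓘(ψ) = (1/2π) ∫_0^{2π} ψ(t) dt`. -/
noncomputable def meanValue (ψ : ℝ → ℝ) : ℝ :=
  1 / (2 * Real.pi) * ∫ t in (0 : ℝ)..(2 * Real.pi), ψ t

/-- A weight normalized by `‖V‖_{L_1([0,1])} = 1`: a non-negative integrable function on `[0,1]`,
different from zero almost everywhere there, with integral `1`. -/
structure IsWeight (V : ℝ → ℝ) : Prop where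
  nonneg : ∀ t ∈ Icc (0 : ℝ) 1, 0 ≤ V t
  integrableOn : IntegrableOn V (Icc (0 : ℝ) 1)
  ae_ne_zero : ∀ᵐ t ∂(volume.restrict (Icc (0 : ℝ) 1)), V t ≠ 0
  integral_eq_one : ∫ t in (0 : ℝ)..1, V t = 1

/-- `Γ(V; t) = ∫_0^1 ψ(ts) V(s) ds`. -/
noncomputable def Gam (ψ V : ℝ → ℝ) (t : ℝ) : ℝ :=
  ∫ s in (0 : ℝ)..1, ψ (t * s) * V s

/-- `𝓖(V, δ, σ) = inf_{|t| ≥ σ} Γ(V; δt)`. -/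
noncomputable def lowerGam (ψ V : ℝ → ℝ) (δ σ : ℝ) : ℝ :=
  ⨅ t : {t : ℝ // σ ≤ |t|}, Gam ψ V (δ * (t : ℝ))

end JacksonStechkin

/-!
The theorem has two independent halves.

**A weight with `Γ(V; t) ≥ 𝓘(ψ)` for all large `|t|`.** Put `g = ψ - 𝓘(ψ)`, a mean-free periodic
function with `g 0 < 0`, and let `g_j` be its mean-free primitive of order `j`. Take
`V(s) = c s ^ (2m - 1) (1 - s) ^ (2m)`. Its derivatives of order below `2m` vanish at `1`, and
those of order below `2m - 1` vanish at `0`, so that repeated integration by parts gives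
`Γ(V; t) - 𝓘(ψ) = c t ^ (-2m) ((2m - 1)! g_{2m}(0) + O(1 / |t|))`
(`IsMeanFree.exists_integral_weightPoly_nonneg`). As `t ^ (-2m) > 0` for both signs of `t`, it is
enough that `g_{2m}(0) > 0` for some `m ≥ 1`. With `c_k` the Fourier coefficients of `g`,
`g_{2m}(0) = (-1) ^ m ∑_{k ≥ 1} 2 Re c_k / k ^ (2m)`. If every `Re c_k` were zero, the even part of
`g` would vanish, against `g 0 ≠ 0`; otherwise the first nonzero `Re c_k` dominates the sum for
large `m`, and the parity of `m` can be chosen to make the expression positive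
(`IsMeanFree.exists_iterate_pos`). The threshold for `|t|` is the point `γ`; dilating by `σ` gives
all `σ > 0`.

**From the weight to the Hilbert space.** With the spectral measure `μ_x(β) = ‖E(β)x‖²`, the
spectral integral is isometric, so `‖Δ_t x‖² = ∫ ψ(ts) dμ_x(s)` (`norm_sq_genDiff`), and
`E_σ(x)² ≤ μ_x(|s| ≥ σ)` (`bestApprox_sq_le`). Integrating `Γ(V; γs/σ) ≥ 𝓘(ψ)` over `|s| ≥ σ` and
exchanging the integrals bounds `𝓘(ψ) E_σ(x)²` by the weighted quadratic mean of `‖Δ_t x‖` over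
`[0, γ/σ]` (`meanValue_mul_bestApprox_sq_le`). Since `V` is a probability density, Jensen's
inequality passes to the means of order `p ≥ 2`, and the supremum is larger still.
-/

namespace JacksonStechkin

/-! ### Mean-free periodic functions and their primitives -/

/-- Continuous `2π`-periodic real functions with mean value zero. -/
structure IsMeanFree (g : ℝ → ℝ) : Prop where
  continuous : Continuous g
  periodic : Function.Periodic g (2 * Real.pi)
  integral_eq_zero : ∫ u in (0 : ℝ)..(2 * Real.pi), g u = 0

/-- The primitive of `g` whose mean value over `[0, 2π]` is zero. -/
noncomputable def meanFreePrimitive (g : ℝ → ℝ) (u : ℝ) : ℝ :=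
  (∫ v in (0 : ℝ)..u, g v) - meanValue fun w => ∫ v in (0 : ℝ)..w, g v

theorem integral_sub_meanValue {f : ℝ → ℝ} (hf : Continuous f) :
    ∫ u in (0 : ℝ)..(2 * Real.pi), (f u - meanValue f) = 0 := by
  rw [intervalIntegral.integral_sub (hf.intervalIntegrable _ _) (by simp), meanValue]
  have := Real.pi_ne_zero
  simp only [intervalIntegral.integral_const, smul_eq_mul, sub_zero]
  field_simp
  ring

theorem IsMeanFree.exists_bound {g : ℝ → ℝ} (hg : IsMeanFree g) : ∃ C, ∀ u, |g u| ≤ C := by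
  obtain ⟨C, hC⟩ := (hg.periodic.isBounded_of_continuous Real.two_pi_pos.ne'
    hg.continuous).exists_norm_le
  exact ⟨C, fun u => hC _ ⟨u, rfl⟩⟩

theorem hasDerivAt_meanFreePrimitive {g : ℝ → ℝ} (hg : Continuous g) (u : ℝ) :
    HasDerivAt (meanFreePrimitive g) (g u) u :=
  (hg.integral_hasStrictDerivAt 0 u).hasDerivAt.sub_const _

theorem IsMeanFree.meanFreePrimitive {g : ℝ → ℝ} (hg : IsMeanFree g) :
    IsMeanFree (meanFreePrimitive g) where
  continuous := continuous_iff_continuousAt.mpr fun u =>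
    (hasDerivAt_meanFreePrimitive hg.continuous u).continuousAt
  periodic u := by
    have hint : ∀ a b, IntervalIntegrable g volume a b := fun a b =>
      hg.continuous.intervalIntegrable a b
    have h := hg.periodic.intervalIntegral_add_eq u 0
    rw [zero_add, hg.integral_eq_zero] at h
    simp only [JacksonStechkin.meanFreePrimitive]
    rw [← intervalIntegral.integral_add_adjacent_intervals (hint 0 u) (hint u _), h, add_zero]
  integral_eq_zero := integral_sub_meanValue
    (continuous_iff_continuousAt.mpr fun u =>
      (hg.continuous.integral_hasStrictDerivAt 0 u).hasDerivAt.continuousAt)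

theorem IsMeanFree.iterate {g : ℝ → ℝ} (hg : IsMeanFree g) (n : ℕ) :
    IsMeanFree (JacksonStechkin.meanFreePrimitive^[n] g) := by
  induction n with
  | zero => exact hg
  | succ n ih => rw [Function.iterate_succ_apply']; exact ih.meanFreePrimitive

/-! ### Fourier coefficients -/

/-- The Fourier coefficient `(1/2π) ∫_0^{2π} e^{-inu} g(u) du`. -/
noncomputable def trigCoeff (g : ℝ → ℝ) (n : ℤ) : ℂ :=
  1 / (2 * Real.pi) * ∫ u in (0 : ℝ)..(2 * Real.pi),
    Complex.exp (-(Complex.I * n * u)) * (g u : ℂ)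

theorem trigCoeff_eq_fourierCoeffOn (g : ℝ → ℝ) (n : ℤ) :
    trigCoeff g n = fourierCoeffOn Real.two_pi_pos (fun u => (g u : ℂ)) n := by
  have hpi : (Real.pi : ℂ) ≠ 0 := by exact_mod_cast Real.pi_ne_zero
  rw [fourierCoeffOn_eq_integral, trigCoeff]
  simp only [fourier_coe_apply, sub_zero, smul_eq_mul, Complex.real_smul]
  push_cast
  congr 1
  refine intervalIntegral.integral_congr fun u _ => ?_
  congr 2
  field_simp

/-- A continuous periodic function with summable Fourier coefficients is the sum of its
Fourier series; at `0` all the exponentials are `1`. -/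
theorem hasSum_trigCoeff_zero {g : ℝ → ℝ} (hg : Continuous g)
    (hp : Function.Periodic g (2 * Real.pi)) (hs : Summable (trigCoeff g)) :
    HasSum (trigCoeff g) (g 0 : ℂ) := by
  have : Fact (0 < 2 * Real.pi) := ⟨Real.two_pi_pos⟩
  have hpi : (Real.pi : ℂ) ≠ 0 := by exact_mod_cast Real.pi_ne_zero
  have hp' : Function.Periodic (fun u => (g u : ℂ)) (2 * Real.pi) := fun u => by
    simp only [hp u]
  let F : C(AddCircle (2 * Real.pi), ℂ) :=
    ⟨hp'.lift, continuous_coinduced_dom.mpr (Complex.continuous_ofReal.comp hg)⟩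
  have hF : ∀ n, fourierCoeff F n = trigCoeff g n := by
    intro n
    rw [fourierCoeff_eq_intervalIntegral F n 0, trigCoeff]
    simp only [fourier_coe_apply, smul_eq_mul, Complex.real_smul, zero_add]
    push_cast
    congr 1
    refine intervalIntegral.integral_congr fun u _ => ?_
    congr 2
    field_simp
  have h := has_pointwise_sum_fourier_series_of_summable (f := F)
    (by simpa only [funext hF] using hs) ((0 : ℝ) : AddCircle (2 * Real.pi))
  have h0 : F ((0 : ℝ) : AddCircle (2 * Real.pi)) = (g 0 : ℂ) := hp'.lift_coe 0
  rw [h0] at h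
  simpa only [hF, fourier_coe_apply, Complex.ofReal_zero, mul_zero, zero_div, Complex.exp_zero,
    smul_eq_mul, mul_one] using h

theorem norm_trigCoeff_le {g : ℝ → ℝ} {C : ℝ} (hC : ∀ u, |g u| ≤ C) (n : ℤ) :
    ‖trigCoeff g n‖ ≤ C := by
  have h : ‖∫ u in (0 : ℝ)..(2 * Real.pi), Complex.exp (-(Complex.I * n * u)) * (g u : ℂ)‖
      ≤ C * |2 * Real.pi - 0| := by
    refine intervalIntegral.norm_integral_le_of_norm_le_const fun u _ => ?_
    have : -(Complex.I * n * u) = ((-(n * u) : ℝ) : ℂ) * Complex.I := by push_cast; ring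
    rw [norm_mul, this, Complex.norm_exp_ofReal_mul_I, one_mul, Complex.norm_real]
    exact hC u
  rw [sub_zero, abs_of_pos Real.two_pi_pos] at h
  rw [trigCoeff, norm_mul]
  have h2 : ‖(1 / (2 * Real.pi) : ℂ)‖ = 1 / (2 * Real.pi) := by
    rw [← Complex.ofReal_ofNat, ← Complex.ofReal_mul, ← Complex.ofReal_one, ← Complex.ofReal_div,
      Complex.norm_real, Real.norm_of_nonneg (by positivity)]
  rw [h2, one_div, inv_mul_le_iff₀ Real.two_pi_pos]
  linarith

theorem IsMeanFree.trigCoeff_zero {g : ℝ → ℝ} (hg : IsMeanFree g) : trigCoeff g 0 = 0 := by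
  simp [trigCoeff, intervalIntegral.integral_ofReal, hg.integral_eq_zero]

theorem conj_trigCoeff (g : ℝ → ℝ) (n : ℤ) :
    (starRingEnd ℂ) (trigCoeff g n) = trigCoeff g (-n) := by
  simp only [trigCoeff, intervalIntegral.integral_of_le Real.two_pi_pos.le]
  rw [map_mul, ← integral_conj]
  simp [← Complex.exp_conj, Complex.conj_ofNat]

/-- For `n = 0` both sides are `0`, the right one by the convention for division by zero. -/
theorem IsMeanFree.trigCoeff_meanFreePrimitive {g : ℝ → ℝ} (hg : IsMeanFree g) (n : ℤ) :
    trigCoeff (JacksonStechkin.meanFreePrimitive g) n = trigCoeff g n / (Complex.I * n) := by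
  rcases eq_or_ne n 0 with rfl | hn
  · rw [hg.trigCoeff_zero, hg.meanFreePrimitive.trigCoeff_zero, zero_div]
  have hpi : (Real.pi : ℂ) ≠ 0 := by exact_mod_cast Real.pi_ne_zero
  have hnC : (n : ℂ) ≠ 0 := by exact_mod_cast hn
  have hper := hg.meanFreePrimitive.periodic 0
  rw [zero_add] at hper
  rw [trigCoeff_eq_fourierCoeffOn, trigCoeff_eq_fourierCoeffOn,
    fourierCoeffOn_of_hasDerivAt Real.two_pi_pos hn
      (fun u _ => (hasDerivAt_meanFreePrimitive hg.continuous u).ofReal_comp)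
      ((Complex.continuous_ofReal.comp hg.continuous).intervalIntegrable _ _), hper]
  have hI := Complex.I_ne_zero
  push_cast
  field_simp
  ring

theorem IsMeanFree.trigCoeff_iterate {g : ℝ → ℝ} (hg : IsMeanFree g) (m : ℕ) (n : ℤ) :
    trigCoeff (JacksonStechkin.meanFreePrimitive^[m] g) n =
      trigCoeff g n / (Complex.I * n) ^ m := by
  induction m with
  | zero => simp
  | succ m ih =>
    rw [Function.iterate_succ_apply', (hg.iterate m).trigCoeff_meanFreePrimitive, ih, div_div,
      pow_succ]

/-- The value at `0` of a primitive of even order, as a Dirichlet series in the real parts of the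
Fourier coefficients. The term `k = 0` vanishes because `g` is mean-free. -/
theorem IsMeanFree.hasSum_iterate_zero {g : ℝ → ℝ} (hg : IsMeanFree g) {m : ℕ} (hm : 1 ≤ m) :
    HasSum (fun k : ℕ => (-1) ^ m * (2 * (trigCoeff g k).re / (k : ℝ) ^ (2 * m)))
      (JacksonStechkin.meanFreePrimitive^[2 * m] g 0) := by
  obtain ⟨C, hC⟩ := hg.exists_bound
  have key : ∀ n : ℤ, trigCoeff (JacksonStechkin.meanFreePrimitive^[2 * m] g) n =
      (-1) ^ m * (trigCoeff g n / (n : ℂ) ^ (2 * m)) := by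
    intro n
    rw [hg.trigCoeff_iterate, mul_pow, pow_mul Complex.I, Complex.I_sq, mul_comm ((-1 : ℂ) ^ m),
      ← div_div, div_right_comm, div_eq_mul_inv _ ((-1 : ℂ) ^ m), ← inv_pow]
    norm_num
    ring
  have hsum : Summable (trigCoeff (JacksonStechkin.meanFreePrimitive^[2 * m] g)) := by
    have h1 : Summable fun n : ℤ => C * (1 / |(n : ℝ)| ^ (2 * m)) := by
      refine Summable.mul_left C ?_
      have := (Real.summable_one_div_int_pow (p := 2 * m)).mpr (by omega)
      simpa only [(even_two_mul m).pow_abs] using this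
    refine Summable.of_norm_bounded h1 fun n => ?_
    rw [key, norm_mul, norm_div, norm_pow, norm_pow, norm_neg, norm_one, one_pow, one_mul,
      Complex.norm_intCast, mul_one_div]
    gcongr
    exact norm_trigCoeff_le hC n
  have h := (hasSum_trigCoeff_zero (hg.iterate _).continuous (hg.iterate _).periodic
    hsum).nat_add_neg
  rw [(hg.iterate _).trigCoeff_zero, add_zero] at h
  have h2 := Complex.hasSum_re h
  rw [Complex.ofReal_re] at h2
  convert h2 using 2 with k
  rw [key, key, ← conj_trigCoeff, Int.cast_neg, (even_two_mul m).neg_pow, ← mul_add, ← add_div,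
    Complex.add_conj]
  norm_cast

/-- A Dirichlet series with bounded coefficients is governed, far to the right, by its first
nonzero coefficient; hence so is its sign. -/
theorem exists_neg_one_pow_mul_tsum_pos {a : ℕ → ℝ} {C : ℝ} (hC : ∀ k, |a k| ≤ C) (h0 : a 0 = 0)
    (hne : ∃ k, a k ≠ 0) :
    ∃ m : ℕ, 1 ≤ m ∧ 0 < (-1) ^ m * ∑' k : ℕ, a k / (k : ℝ) ^ (2 * m) := by
  classical
  obtain ⟨k₀, hk₀, hmin⟩ : ∃ k, a k ≠ 0 ∧ ∀ j < k, a j = 0 :=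
    ⟨Nat.find hne, Nat.find_spec hne, fun j hj => not_not.mp (Nat.find_min hne hj)⟩
  have hk₀pos : 0 < k₀ := Nat.pos_of_ne_zero fun h => hk₀ (h ▸ h0)
  have hk₀R : (0 : ℝ) < k₀ := by exact_mod_cast hk₀pos
  have hlim : Tendsto (fun m : ℕ => ∑' k : ℕ, a k * ((k₀ : ℝ) / k) ^ (2 * (m + 1))) atTop
      (𝓝 (∑' k : ℕ, if k = k₀ then a k₀ else 0)) := by
    refine tendsto_tsum_of_dominated_convergence
      (bound := fun k : ℕ => C * (k₀ : ℝ) ^ 2 * (1 / (k : ℝ) ^ 2)) ?_ ?_ ?_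
    · exact (Real.summable_one_div_nat_pow.mpr one_lt_two).mul_left _
    · intro k
      rcases lt_trichotomy k k₀ with hk | rfl | hk
      · simp [hmin k hk, hk.ne]
      · simp [hk₀R.ne']
      · have hkR : (k₀ : ℝ) < k := by exact_mod_cast hk
        rw [if_neg hk.ne', ← mul_zero (a k)]
        refine Tendsto.const_mul _ ?_
        have hq0 : (0 : ℝ) ≤ (k₀ : ℝ) / k := by positivity
        have hq1 : (k₀ : ℝ) / k < 1 := (div_lt_one (hk₀R.trans hkR)).mpr hkR
        exact (tendsto_pow_atTop_nhds_zero_of_lt_one hq0 hq1).comp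
          (tendsto_atTop_mono (fun m => by simp only [id]; omega) tendsto_id)
    · refine Eventually.of_forall fun m k => ?_
      have hCk : 0 ≤ C := (abs_nonneg _).trans (hC k)
      rcases lt_or_ge k k₀ with hk | hk
      · rw [hmin k hk, zero_mul, norm_zero]
        positivity
      · have hkR : (k₀ : ℝ) ≤ k := by exact_mod_cast hk
        have hq0 : (0 : ℝ) ≤ (k₀ : ℝ) / k := by positivity
        have hq1 : (k₀ : ℝ) / k ≤ 1 := div_le_one_of_le₀ hkR (by positivity)
        rw [norm_mul, Real.norm_eq_abs, norm_pow, Real.norm_of_nonneg hq0, mul_assoc, mul_one_div,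
          ← div_pow]
        exact mul_le_mul (hC k) (pow_le_pow_of_le_one hq0 hq1 (by omega)) (by positivity) hCk
  rw [tsum_ite_eq] at hlim
  have hscale : ∀ m : ℕ, ∑' k : ℕ, a k * ((k₀ : ℝ) / k) ^ (2 * (m + 1)) =
      (k₀ : ℝ) ^ (2 * (m + 1)) * ∑' k : ℕ, a k / (k : ℝ) ^ (2 * (m + 1)) := by
    intro m
    rw [← tsum_mul_left]
    refine tsum_congr fun k => ?_
    rw [div_pow]
    ring
  simp only [hscale] at hlim
  -- the parity of `m` is chosen to match the sign of the leading coefficient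
  rcases hk₀.lt_or_gt with hneg | hpos
  · obtain ⟨N, hN⟩ := eventually_atTop.mp (hlim.eventually (gt_mem_nhds hneg))
    have h := neg_of_mul_neg_right (hN (2 * N) (by omega)) (by positivity)
    refine ⟨2 * N + 1, by omega, ?_⟩
    rw [(odd_two_mul_add_one N).neg_one_pow]
    linarith
  · obtain ⟨N, hN⟩ := eventually_atTop.mp (hlim.eventually (lt_mem_nhds hpos))
    have h := pos_of_mul_pos_right (hN (2 * N + 1) (by omega)) (by positivity)
    refine ⟨2 * N + 1 + 1, by omega, ?_⟩
    rw [show 2 * N + 1 + 1 = 2 * (N + 1) by ring, (even_two_mul (N + 1)).neg_one_pow, one_mul]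
    exact h

/-- If all real parts vanished, `u ↦ g u + g (-u)` would have no Fourier coefficients and would be
identically zero. -/
theorem IsMeanFree.exists_re_trigCoeff_ne_zero {g : ℝ → ℝ} (hg : IsMeanFree g) (h0 : g 0 ≠ 0) :
    ∃ k : ℕ, (trigCoeff g k).re ≠ 0 := by
  by_contra! hre
  have hre' : ∀ n : ℤ, (trigCoeff g n).re = 0 := by
    intro n
    obtain ⟨k, rfl | rfl⟩ := n.eq_nat_or_neg
    · exact hre k
    · rw [← conj_trigCoeff, Complex.conj_re, hre]
  have hneg : ∀ n : ℤ, trigCoeff (fun u => g (-u)) n = trigCoeff g (-n) := by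
    intro n
    have hp : Function.Periodic
        (fun u : ℝ => Complex.exp (-(Complex.I * (-n : ℤ) * u)) * (g u : ℂ)) (2 * Real.pi) := by
      intro u
      have : -(Complex.I * (-n : ℤ) * ((u + 2 * Real.pi : ℝ) : ℂ)) =
          -(Complex.I * (-n : ℤ) * u) + n * (2 * Real.pi * Complex.I) := by push_cast; ring
      simp only
      rw [hg.periodic u, this, Complex.exp_add, Complex.exp_int_mul_two_pi_mul_I, mul_one]
    have h1 := hp.intervalIntegral_add_eq (-(2 * Real.pi)) 0
    rw [neg_add_cancel, zero_add] at h1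
    rw [trigCoeff, trigCoeff, ← h1]
    have h2 := intervalIntegral.integral_comp_neg (a := 0) (b := 2 * Real.pi)
      (fun u : ℝ => Complex.exp (-(Complex.I * (-n : ℤ) * u)) * (g u : ℂ))
    rw [neg_zero] at h2
    rw [← h2]
    congr 1
    refine intervalIntegral.integral_congr fun u _ => ?_
    push_cast
    congr 2
    ring
  have hz : ∀ n, trigCoeff (fun u => g u + g (-u)) n = 0 := by
    intro n
    have hadd : trigCoeff (fun u => g u + g (-u)) n =
        trigCoeff g n + trigCoeff (fun u => g (-u)) n := by
      have hc := hg.continuous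
      rw [trigCoeff, trigCoeff, trigCoeff, ← mul_add, ← intervalIntegral.integral_add
        (Continuous.intervalIntegrable (by fun_prop) _ _)
        (Continuous.intervalIntegrable (by fun_prop) _ _)]
      push_cast
      simp only [mul_add]
    rw [hadd, hneg, ← conj_trigCoeff, Complex.add_conj, hre', mul_zero, Complex.ofReal_zero]
  have hper : Function.Periodic (fun u => g u + g (-u)) (2 * Real.pi) := by
    intro u
    have := hg.periodic (-u - 2 * Real.pi)
    rw [sub_add_cancel] at this
    simp only [hg.periodic u, this, neg_add']
  have hcont : Continuous fun u => g u + g (-u) :=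
    hg.continuous.add (hg.continuous.comp continuous_neg)
  have hsum := hasSum_trigCoeff_zero hcont hper
    (by rw [funext hz]; exact summable_zero)
  rw [funext hz] at hsum
  have := hasSum_zero.unique hsum
  have h2 : g 0 + g (-0) = 0 := by exact_mod_cast this.symm
  rw [neg_zero] at h2
  exact h0 (by linarith)

/-- Some primitive of even order is positive at `0`. -/
theorem IsMeanFree.exists_iterate_pos {g : ℝ → ℝ} (hg : IsMeanFree g) (h0 : g 0 ≠ 0) :
    ∃ m : ℕ, 1 ≤ m ∧ 0 < JacksonStechkin.meanFreePrimitive^[2 * m] g 0 := by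
  obtain ⟨C, hC⟩ := hg.exists_bound
  obtain ⟨k, hk⟩ := hg.exists_re_trigCoeff_ne_zero h0
  obtain ⟨m, hm, hpos⟩ := exists_neg_one_pow_mul_tsum_pos
    (a := fun k : ℕ => 2 * (trigCoeff g k).re) (C := 2 * C)
    (fun k => by
      rw [abs_mul, abs_two]
      exact mul_le_mul_of_nonneg_left
        ((Complex.abs_re_le_norm _).trans (norm_trigCoeff_le hC k)) zero_le_two)
    (by simp [hg.trigCoeff_zero]) ⟨k, mul_ne_zero two_ne_zero hk⟩
  refine ⟨m, hm, ?_⟩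
  rw [← (hg.hasSum_iterate_zero hm).tsum_eq, tsum_mul_left]
  exact hpos

/-! ### Integration by parts against a polynomial -/

theorem integral_comp_mul_left_mul_polynomial {g : ℝ → ℝ} (hg : Continuous g) (Q : Polynomial ℝ)
    {t : ℝ} (ht : t ≠ 0) :
    ∫ s in (0 : ℝ)..1, g (t * s) * Q.eval s =
      t⁻¹ * (meanFreePrimitive g t * Q.eval 1 - meanFreePrimitive g 0 * Q.eval 0 -
        ∫ s in (0 : ℝ)..1, meanFreePrimitive g (t * s) * Q.derivative.eval s) := by
  have hd : ∀ s, HasDerivAt (fun s => t⁻¹ * meanFreePrimitive g (t * s)) (g (t * s)) s := by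
    intro s
    have h := ((hasDerivAt_meanFreePrimitive hg (t * s)).comp s
      ((hasDerivAt_id s).const_mul t)).const_mul t⁻¹
    rwa [mul_one, mul_comm (g _) t, inv_mul_cancel_left₀ ht] at h
  have hcomp : Continuous fun s => g (t * s) := by fun_prop
  have h := intervalIntegral.integral_mul_deriv_eq_deriv_mul (a := 0) (b := 1)
    (fun s _ => Q.hasDerivAt s) (fun s _ => hd s)
    (Q.derivative.continuous.intervalIntegrable _ _) (hcomp.intervalIntegrable _ _)
  simp only [mul_comm (g _), h, mul_sub, ← intervalIntegral.integral_const_mul, mul_one, mul_zero]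
  congr 1
  · ring
  · refine intervalIntegral.integral_congr fun s _ => ?_
    ring

theorem integral_eq_iterate_of_vanishing {g : ℝ → ℝ} (hg : IsMeanFree g) (Q : Polynomial ℝ) (n : ℕ)
    (h0 : ∀ i < n, (Polynomial.derivative^[i] Q).eval 0 = 0)
    (h1 : ∀ i < n, (Polynomial.derivative^[i] Q).eval 1 = 0) {t : ℝ} (ht : t ≠ 0) :
    ∫ s in (0 : ℝ)..1, g (t * s) * Q.eval s =
      (-t⁻¹) ^ n * ∫ s in (0 : ℝ)..1, meanFreePrimitive^[n] g (t * s) *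
        (Polynomial.derivative^[n] Q).eval s := by
  induction n with
  | zero => simp
  | succ n ih =>
    rw [ih (fun i hi => h0 i (by omega)) (fun i hi => h1 i (by omega)),
      integral_comp_mul_left_mul_polynomial (hg.iterate n).continuous _ ht,
      h0 n (by omega), h1 n (by omega), Function.iterate_succ_apply', Function.iterate_succ_apply']
    ring

/-- The unnormalized weight. Its order of vanishing at `0` is `2m - 1`, and at `1` it is higher
by one, so that only the endpoint `0` contributes to the leading asymptotic term. -/
noncomputable def weightPoly (m : ℕ) : Polynomial ℝ :=
  Polynomial.X ^ (2 * m - 1) * (1 - Polynomial.X) ^ (2 * m)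

theorem eval_weightPoly (m : ℕ) (s : ℝ) :
    (weightPoly m).eval s = s ^ (2 * m - 1) * (1 - s) ^ (2 * m) := by
  simp [weightPoly]

theorem iterate_derivative_weightPoly_eval_zero (m : ℕ) {i : ℕ} (hi : i < 2 * m - 1) :
    (Polynomial.derivative^[i] (weightPoly m)).eval 0 = 0 := by
  rw [← Polynomial.coeff_zero_eq_eval_zero, Polynomial.coeff_iterate_derivative, weightPoly,
    Polynomial.coeff_X_pow_mul', if_neg (by omega), smul_zero]

theorem iterate_derivative_weightPoly_eval_zero_pos (m : ℕ) :
    0 < (Polynomial.derivative^[2 * m - 1] (weightPoly m)).eval 0 := by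
  rw [← Polynomial.coeff_zero_eq_eval_zero, Polynomial.coeff_iterate_derivative, weightPoly,
    Polynomial.coeff_X_pow_mul', if_pos (by omega), zero_add, Nat.sub_self,
    Polynomial.coeff_zero_eq_eval_zero, Nat.descFactorial_self]
  simp [Nat.factorial_pos]

theorem iterate_derivative_weightPoly_eval_one (m : ℕ) {i : ℕ} (hi : i < 2 * m) :
    (Polynomial.derivative^[i] (weightPoly m)).eval 1 = 0 := by
  obtain ⟨q, hq⟩ := Polynomial.pow_sub_dvd_iterate_derivative_of_pow_dvd i
    (Dvd.intro_left _ rfl : (1 - Polynomial.X : Polynomial ℝ) ^ (2 * m) ∣ weightPoly m)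
  rw [hq, Polynomial.eval_mul, Polynomial.eval_pow]
  simp [Nat.sub_ne_zero_of_lt hi]

/-- Integrating by parts `2m + 1` times, the integral is
`t ^ (-2m) * ((2m - 1)! * g_{2m}(0) + O(1 / |t|))`, where `g_{2m}` is the primitive of order `2m`;
hence it is positive for large `|t|`. -/
theorem IsMeanFree.exists_integral_weightPoly_nonneg {g : ℝ → ℝ} (hg : IsMeanFree g) {m : ℕ}
    (hm : 1 ≤ m) (hpos : 0 < JacksonStechkin.meanFreePrimitive^[2 * m] g 0) :
    ∃ γ : ℝ, 0 < γ ∧ ∀ t, γ ≤ |t| →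
      0 ≤ ∫ s in (0 : ℝ)..1, g (t * s) * (weightPoly m).eval s := by
  set P := weightPoly m
  set A := (Polynomial.derivative^[2 * m - 1] P).eval 0
  have hA : 0 < A := iterate_derivative_weightPoly_eval_zero_pos m
  set G := JacksonStechkin.meanFreePrimitive^[2 * m] g
  have hG : IsMeanFree G := hg.iterate _
  set Q := Polynomial.derivative^[2 * m] P
  -- a bound, uniform in `t`, for the boundary terms and the integral of the last step
  obtain ⟨B, hB⟩ := hG.meanFreePrimitive.exists_bound
  have hB0 : 0 ≤ B := (abs_nonneg _).trans (hB 0)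
  obtain ⟨D, hD⟩ := (isCompact_Icc (a := (0 : ℝ)) (b := 1)).exists_bound_of_continuousOn
    Q.derivative.continuous.continuousOn
  set K := B * |Q.eval 1| + B * |Q.eval 0| + B * D
  have hK : ∀ t : ℝ, t ≠ 0 → |∫ s in (0 : ℝ)..1, G (t * s) * Q.eval s| ≤ |t|⁻¹ * K := by
    intro t ht
    have hlast : |∫ s in (0 : ℝ)..1,
        JacksonStechkin.meanFreePrimitive G (t * s) * Q.derivative.eval s| ≤ B * D := by
      have := intervalIntegral.norm_integral_le_of_norm_le_const (a := (0 : ℝ)) (b := 1)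
        (C := B * D)
        (f := fun s => JacksonStechkin.meanFreePrimitive G (t * s) * Q.derivative.eval s)
        (fun s hs => by
          rw [uIoc_of_le zero_le_one] at hs
          rw [norm_mul]
          exact mul_le_mul (hB _) (hD s (Ioc_subset_Icc_self hs)) (norm_nonneg _) hB0)
      simpa using this
    rw [integral_comp_mul_left_mul_polynomial hG.continuous Q ht, abs_mul, abs_inv]
    gcongr
    refine (abs_sub _ _).trans (add_le_add ((abs_sub _ _).trans (add_le_add ?_ ?_)) hlast)
    · rw [abs_mul]
      gcongr
      exact hB t
    · rw [abs_mul]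
      gcongr
      exact hB 0
  have hAG : 0 < A * G 0 := mul_pos hA hpos
  refine ⟨max 1 (K / (A * G 0)), by positivity, fun t ht => ?_⟩
  have ht1 : 1 ≤ |t| := (le_max_left _ _).trans ht
  have ht0 : t ≠ 0 := by
    rintro rfl
    norm_num at ht1
  have hsmall : |∫ s in (0 : ℝ)..1, G (t * s) * Q.eval s| ≤ A * G 0 := by
    refine (hK t ht0).trans ?_
    rw [inv_mul_le_iff₀ (by linarith)]
    exact (div_le_iff₀ hAG).mp ((le_max_right _ _).trans ht)
  have hodd : 2 * m - 1 + 1 = 2 * m := by omega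
  have hformula : ∫ s in (0 : ℝ)..1, g (t * s) * P.eval s =
      t⁻¹ ^ (2 * m) * (G 0 * A + ∫ s in (0 : ℝ)..1, G (t * s) * Q.eval s) := by
    rw [integral_eq_iterate_of_vanishing hg P (2 * m - 1)
      (fun i hi => iterate_derivative_weightPoly_eval_zero m hi)
      (fun i hi => iterate_derivative_weightPoly_eval_one m (by omega)) ht0,
      integral_comp_mul_left_mul_polynomial (hg.iterate _).continuous _ ht0,
      iterate_derivative_weightPoly_eval_one m (by omega),
      ← Function.iterate_succ_apply' JacksonStechkin.meanFreePrimitive,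
      ← Function.iterate_succ_apply' Polynomial.derivative, Nat.succ_eq_add_one, hodd,
      Odd.neg_pow ⟨m - 1, by omega⟩, ← pow_sub_one_mul (by omega : 2 * m ≠ 0) t⁻¹]
    ring
  rw [hformula]
  have := (abs_le.mp hsmall).1
  exact mul_nonneg ((even_two_mul m).pow_nonneg _) (by linarith)

/-! ### The weight -/

theorem IsPhi.meanValue_pos {ψ : ℝ → ℝ} (hψ : IsPhi ψ) : 0 < meanValue ψ := by
  have hpi := Real.two_pi_pos
  refine mul_pos (by positivity) ?_
  obtain ⟨t, ht, hne⟩ : ∃ t ∈ Ioo (0 : ℝ) (2 * Real.pi), ψ t ≠ 0 := by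
    by_contra! h
    have hsub : Ioo (0 : ℝ) (2 * Real.pi) ⊆ interior (closure {t | ψ t = 0}) :=
      (isOpen_Ioo.subset_interior_iff.mpr h).trans (interior_mono subset_closure)
    rw [hψ.isNowhereDense_zeros] at hsub
    exact hsub (show Real.pi ∈ _ from ⟨Real.pi_pos, by linarith [Real.pi_pos]⟩)
  exact intervalIntegral.integral_pos hpi hψ.continuous.continuousOn (fun t _ => hψ.nonneg t)
    ⟨t, Ioo_subset_Icc_self ht, (hψ.nonneg t).lt_of_ne' hne⟩

/-- A threshold `γ` and a continuous weight with `Γ(V; t) ≥ 𝓘(ψ)` for all `|t| ≥ γ`. -/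
theorem IsPhi.exists_weight {ψ : ℝ → ℝ} (hψ : IsPhi ψ) :
    ∃ γ : ℝ, 0 < γ ∧ ∃ V : ℝ → ℝ, Continuous V ∧ IsWeight V ∧
      ∀ t, γ ≤ |t| → meanValue ψ ≤ Gam ψ V t := by
  set g : ℝ → ℝ := fun u => ψ u - meanValue ψ
  have hg : IsMeanFree g :=
    ⟨hψ.continuous.sub continuous_const, fun u => by simp only [g, hψ.periodic u],
      integral_sub_meanValue hψ.continuous⟩
  have hg0 : g 0 ≠ 0 := by
    simp only [g, hψ.map_zero, zero_sub]
    exact neg_ne_zero.mpr hψ.meanValue_pos.ne'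
  obtain ⟨m, hm, hpos⟩ := hg.exists_iterate_pos hg0
  obtain ⟨γ, hγ, hint⟩ := hg.exists_integral_weightPoly_nonneg hm hpos
  set P := weightPoly m
  have hP : Continuous fun s => P.eval s := P.continuous
  have hPpos : ∀ s ∈ Ioo (0 : ℝ) 1, 0 < P.eval s := by
    intro s hs
    have h1 := hs.1
    have h2 := sub_pos.mpr hs.2
    rw [eval_weightPoly]
    positivity
  have hPnonneg : ∀ s ∈ Icc (0 : ℝ) 1, 0 ≤ P.eval s := by
    intro s hs
    have h1 := hs.1
    have h2 := sub_nonneg.mpr hs.2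
    rw [eval_weightPoly]
    positivity
  have hZ : 0 < ∫ s in (0 : ℝ)..1, P.eval s :=
    intervalIntegral.integral_pos zero_lt_one hP.continuousOn
      (fun s hs => hPnonneg s (Ioc_subset_Icc_self hs))
      ⟨1 / 2, by norm_num, hPpos _ (by norm_num)⟩
  set Z := ∫ s in (0 : ℝ)..1, P.eval s
  have hV : IsWeight fun s => Z⁻¹ * P.eval s := by
    refine ⟨fun s hs => mul_nonneg (by positivity) (hPnonneg s hs),
      (hP.const_mul _).integrableOn_Icc, ?_, ?_⟩
    · rw [← restrict_Ioo_eq_restrict_Icc, ae_restrict_iff' measurableSet_Ioo]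
      exact Eventually.of_forall fun s hs => mul_ne_zero (by positivity) (hPpos s hs).ne'
    · rw [intervalIntegral.integral_const_mul]
      exact inv_mul_cancel₀ hZ.ne'
  refine ⟨γ, hγ, _, hP.const_mul _, hV, fun t ht => ?_⟩
  have hcomp : Continuous fun s => ψ (t * s) := hψ.continuous.comp (continuous_const_mul t)
  have h := hint t ht
  simp only [g, sub_mul] at h
  have hcompP : Continuous fun s => ψ (t * s) * P.eval s := hcomp.mul hP
  rw [intervalIntegral.integral_sub (hcompP.intervalIntegrable _ _)
    ((hP.const_mul _).intervalIntegrable _ _), intervalIntegral.integral_const_mul] at h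
  simp only [Gam, mul_left_comm _ Z⁻¹]
  rw [intervalIntegral.integral_const_mul, le_inv_mul_iff₀ hZ]
  linarith

/-! ### The spectral integral is isometric -/

section Spectral

variable {H : Type*} [NormedAddCommGroup H] [InnerProductSpace ℂ H] [CompleteSpace H]

theorem ResolutionOfIdentity.proj_proj (E : ResolutionOfIdentity H) {A : Set ℝ}
    (hA : MeasurableSet A) (x : H) : E.proj A (E.proj A x) = E.proj A x := by
  simpa using congrArg (fun T : H →L[ℂ] H => T x) (E.isStarProjection A hA).isIdempotentElem.eq

theorem ResolutionOfIdentity.norm_sq_union (E : ResolutionOfIdentity H) {A B : Set ℝ}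
    (hA : MeasurableSet A) (hB : MeasurableSet B) (hAB : Disjoint A B) (x : H) :
    ‖E.proj (A ∪ B) x‖ ^ 2 = ‖E.proj A x‖ ^ 2 + ‖E.proj B x‖ ^ 2 := by
  have h := measureReal_union (μ := E.measure x) hAB hB
  simpa only [measureReal_def, E.measure_apply x hA, E.measure_apply x hB,
    E.measure_apply x (hA.union hB), ENNReal.toReal_ofReal (sq_nonneg _)] using h

/-- Additivity of `‖E(·)y‖²` at `y = E(A)x` leaves no room for `E(B)y`, as `E(A ∪ B)` is a
contraction. -/
theorem ResolutionOfIdentity.proj_proj_of_disjoint (E : ResolutionOfIdentity H) {A B : Set ℝ}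
    (hA : MeasurableSet A) (hB : MeasurableSet B) (hAB : Disjoint A B) (x : H) :
    E.proj B (E.proj A x) = 0 := by
  have h := E.norm_sq_union hA hB hAB (E.proj A x)
  have hle : ‖E.proj (A ∪ B) (E.proj A x)‖ ≤ ‖E.proj A x‖ := by
    have := (E.proj (A ∪ B)).le_of_opNorm_le
      ((E.isStarProjection _ (hA.union hB)).norm_le) (E.proj A x)
    simpa using this
  have hsq := pow_le_pow_left₀ (norm_nonneg _) hle 2
  rw [h, E.proj_proj hA] at hsq
  exact norm_eq_zero.mp (pow_eq_zero_iff two_ne_zero |>.mp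
    (le_antisymm (by linarith) (sq_nonneg _)))

theorem ResolutionOfIdentity.inner_proj_proj_of_disjoint (E : ResolutionOfIdentity H)
    {A B : Set ℝ} (hA : MeasurableSet A) (hB : MeasurableSet B) (hAB : Disjoint A B) (x : H) :
    inner ℂ (E.proj A x) (E.proj B x) = 0 := by
  have hadj : ContinuousLinearMap.adjoint (E.proj A) = E.proj A :=
    (E.isStarProjection A hA).isSelfAdjoint
  rw [← hadj, ContinuousLinearMap.adjoint_inner_left,
    E.proj_proj_of_disjoint hB hA hAB.symm, inner_zero_right]

theorem norm_sq_spectral_simpleFunc (E : ResolutionOfIdentity H) (f : SimpleFunc ℝ ℂ) (x : H) :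
    ‖(∑ c ∈ f.range, c • E.proj (f ⁻¹' {c})) x‖ ^ 2 = ∫ s, ‖f s‖ ^ 2 ∂(E.measure x) := by
  have hm : ∀ c, MeasurableSet (f ⁻¹' {c}) := fun c => f.measurableSet_preimage _
  have hint : ∫ s, ‖f s‖ ^ 2 ∂(E.measure x) =
      ∑ c ∈ f.range, ‖c‖ ^ 2 * ‖E.proj (f ⁻¹' {c}) x‖ ^ 2 := by
    have h := SimpleFunc.map_integral (μ := E.measure x) f (fun c : ℂ => ‖c‖ ^ 2)
      (SimpleFunc.integrable_of_isFiniteMeasure f) (by simp)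
    rw [SimpleFunc.integral_eq_integral _ (SimpleFunc.integrable_of_isFiniteMeasure _)] at h
    refine Eq.trans ?_ (h.trans (Finset.sum_congr rfl fun c _ => ?_))
    · rfl
    · rw [measureReal_def, E.measure_apply x (hm c), ENNReal.toReal_ofReal (sq_nonneg _),
        smul_eq_mul, mul_comm]
  have horth : ∀ c d : ℂ, c ≠ d →
      inner ℂ (E.proj (f ⁻¹' {c}) x) (E.proj (f ⁻¹' {d}) x) = 0 := fun c d hcd =>
    E.inner_proj_proj_of_disjoint (hm c) (hm d)
      (Disjoint.preimage _ (disjoint_singleton.mpr hcd)) x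
  have hC : ((‖(∑ c ∈ f.range, c • E.proj (f ⁻¹' {c})) x‖ ^ 2 : ℝ) : ℂ) =
      ((∑ c ∈ f.range, ‖c‖ ^ 2 * ‖E.proj (f ⁻¹' {c}) x‖ ^ 2 : ℝ) : ℂ) := by
    have h1 := inner_self_eq_norm_sq_to_K (𝕜 := ℂ) ((∑ c ∈ f.range, c • E.proj (f ⁻¹' {c})) x)
    rw [Complex.ofReal_pow]
    refine h1.symm.trans ?_
    rw [sum_apply, sum_inner, Complex.ofReal_sum]
    refine Finset.sum_congr rfl fun c hc => ?_
    rw [inner_sum, Finset.sum_eq_single c]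
    · rw [smul_apply, inner_smul_left, inner_smul_right, inner_self_eq_norm_sq_to_K, ← mul_assoc,
        mul_comm ((starRingEnd ℂ) c), Complex.mul_conj, Complex.normSq_eq_norm_sq]
      push_cast
      rfl
    · intro d _ hd
      rw [smul_apply, smul_apply, inner_smul_left, inner_smul_right, horth c d hd.symm, mul_zero,
        mul_zero]
    · exact fun h => absurd hc h
  rw [hint]
  exact_mod_cast hC

theorem norm_sq_spectralIntegral (E : ResolutionOfIdentity H) {F : ℝ → ℂ} (hF : Measurable F)
    {M : ℝ} (hM : ∀ s, ‖F s‖ ≤ M) (x : H) :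
    ‖spectralIntegral E F x‖ ^ 2 = ∫ s, ‖F s‖ ^ 2 ∂(E.measure x) := by
  have hpos : ∀ n : ℕ, (0 : ℝ) < 1 / ((n : ℝ) + 1) := fun n => Nat.one_div_pos_of_nat
  have hlim : Tendsto (fun n : ℕ => 1 / ((n : ℝ) + 1)) atTop (𝓝 0) :=
    tendsto_one_div_add_atTop_nhds_zero_nat
  choose f hf using fun n : ℕ => exists_simpleFunc_near hF hM (hpos n)
  let T : ℕ → H →L[ℂ] H := fun n => ∑ c ∈ (f n).range, c • E.proj (f n ⁻¹' {c})
  have hFint : ∀ x, Integrable F (E.measure x) := fun x =>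
    Integrable.of_bound hF.aestronglyMeasurable M (Eventually.of_forall hM)
  have hT : Tendsto T atTop (𝓝 (spectralIntegral E F)) := by
    rw [tendsto_iff_norm_sub_tendsto_zero]
    refine squeeze_zero (g := fun n : ℕ => 2 * (1 / ((n : ℝ) + 1))) (fun _ => norm_nonneg _)
      (fun n => ?_) (by simpa using hlim.const_mul 2)
    refine norm_le_of_quadratic _ (hpos n).le fun y => ?_
    rw [sub_apply, inner_sub_right, isSpectralIntegral_simpleFunc E (f n) y,
      isSpectralIntegral_spectralIntegral E hF hM y,
      ← integral_sub (SimpleFunc.integrable_of_isFiniteMeasure _) (hFint y)]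
    refine (norm_integral_le_of_norm_le_const (Eventually.of_forall (hf n))).trans_eq ?_
    rw [E.measureReal_univ]
  have h1 : Tendsto (fun n => ‖T n x‖ ^ 2) atTop (𝓝 (‖spectralIntegral E F x‖ ^ 2)) :=
    ((((ContinuousLinearMap.apply ℂ H x).continuous.tendsto _).comp hT).norm).pow 2
  have h2 : Tendsto (fun n => ∫ s, ‖f n s‖ ^ 2 ∂(E.measure x)) atTop
      (𝓝 (∫ s, ‖F s‖ ^ 2 ∂(E.measure x))) := by
    refine tendsto_integral_of_dominated_convergence (fun _ => (M + 1) ^ 2)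
      (fun n => ((f n).measurable.norm.pow_const 2).aestronglyMeasurable) (integrable_const _)
      (fun n => Eventually.of_forall fun s => ?_) (Eventually.of_forall fun s => ?_)
    · rw [norm_pow, norm_norm]
      have h3 : 1 / ((n : ℝ) + 1) ≤ 1 := by
        rw [div_le_one (by positivity)]
        linarith [(Nat.cast_nonneg n : (0 : ℝ) ≤ n)]
      have h4 : ‖f n s‖ ≤ M + 1 := by
        have := norm_add_le (f n s - F s) (F s)
        rw [sub_add_cancel] at this
        linarith [hf n s, hM s]
      gcongr
    · have h3 : Tendsto (fun n => f n s) atTop (𝓝 (F s)) := by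
        rw [tendsto_iff_norm_sub_tendsto_zero]
        exact squeeze_zero (fun _ => norm_nonneg _) (fun n => hf n s) hlim
      exact h3.norm.pow 2
  refine tendsto_nhds_unique h1 ?_
  simpa only [T, norm_sq_spectral_simpleFunc] using h2

/-! ### Generalized differences -/

theorem exists_norm_exp_le {φ : ℂ → ℂ} (hφ : Continuous φ) :
    ∃ M : ℝ, ∀ t s : ℝ, ‖φ (Complex.exp (Complex.I * (t : ℂ) * (s : ℂ)))‖ ≤ M := by
  obtain ⟨M, hM⟩ := (isCompact_sphere (0 : ℂ) 1).exists_bound_of_continuousOn hφ.continuousOn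
  refine ⟨M, fun t s => hM _ ?_⟩
  have : Complex.I * (t : ℂ) * (s : ℂ) = ((t * s : ℝ) : ℂ) * Complex.I := by push_cast; ring
  rw [mem_sphere_zero_iff_norm, this, Complex.norm_exp_ofReal_mul_I]

theorem norm_sq_genDiff {φ : ℂ → ℂ} (hφ : Continuous φ) (E : ResolutionOfIdentity H) (t : ℝ)
    (x : H) : ‖genDiff φ E t x‖ ^ 2 = ∫ s, psiOf φ (t * s) ∂(E.measure x) := by
  obtain ⟨M, hM⟩ := exists_norm_exp_le hφ
  have hmeas : Measurable fun s : ℝ => φ (Complex.exp (Complex.I * (t : ℂ) * (s : ℂ))) :=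
    Continuous.measurable (by fun_prop)
  rw [genDiff, norm_sq_spectralIntegral E hmeas (hM t)]
  simp only [psiOf, Complex.ofReal_mul, mul_assoc]

theorem exists_psiOf_le {φ : ℂ → ℂ} (hφ : Continuous φ) : ∃ M : ℝ, ∀ t, psiOf φ t ≤ M := by
  obtain ⟨M, hM⟩ := exists_norm_exp_le hφ
  refine ⟨M ^ 2, fun t => ?_⟩
  have := pow_le_pow_left₀ (norm_nonneg _) (hM t 1) 2
  simpa [psiOf] using this

theorem continuous_psiOf {φ : ℂ → ℂ} (hφ : Continuous φ) : Continuous (psiOf φ) := by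
  unfold psiOf
  fun_prop

theorem psiOf_nonneg (φ : ℂ → ℂ) (t : ℝ) : 0 ≤ psiOf φ t := sq_nonneg _

theorem continuous_norm_genDiff {φ : ℂ → ℂ} (hφ : Continuous φ) (E : ResolutionOfIdentity H)
    (x : H) : Continuous fun t => ‖genDiff φ E t x‖ := by
  obtain ⟨M, hM⟩ := exists_psiOf_le hφ
  have hc := continuous_psiOf hφ
  have h : Continuous fun t => ‖genDiff φ E t x‖ ^ 2 := by
    simp only [norm_sq_genDiff hφ]
    refine continuous_of_dominated (bound := fun _ => M)
      (fun t => (hc.comp (continuous_const_mul t)).aestronglyMeasurable)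
      (fun t => Eventually.of_forall fun s => ?_) (integrable_const _)
      (Eventually.of_forall fun s => hc.comp (continuous_mul_const s))
    rw [Real.norm_of_nonneg (psiOf_nonneg φ _)]
    exact hM _
  simpa only [Real.sqrt_sq (norm_nonneg _)] using h.sqrt

theorem norm_genDiff_le_modulus {φ : ℂ → ℂ} (hφ : Continuous φ) (E : ResolutionOfIdentity H)
    (x : H) {t δ : ℝ} (ht : t ∈ Icc 0 δ) : ‖genDiff φ E t x‖ ≤ modulus φ E x δ := by
  have hbdd : BddAbove (range fun t : Icc (0 : ℝ) δ => ‖genDiff φ E (t : ℝ) x‖) := by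
    have := (isCompact_Icc (a := (0 : ℝ)) (b := δ)).bddAbove_image
      (continuous_norm_genDiff hφ E x).continuousOn
    rwa [image_eq_range] at this
  exact le_ciSup hbdd ⟨t, ht⟩

/-- The best approximation is at most the mass of the spectral measure outside the band. -/
theorem bestApprox_sq_le (E : ResolutionOfIdentity H) (σ : ℝ) (x : H) :
    bestApprox E σ x ^ 2 ≤ (E.measure x).real {s | σ ≤ |s|} := by
  have hB : MeasurableSet {t : ℝ | |t| < σ} :=
    measurableSet_lt continuous_abs.measurable measurable_const
  have hBc : {s : ℝ | σ ≤ |s|} = {t : ℝ | |t| < σ}ᶜ := by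
    ext s
    simp
  have hle : bestApprox E σ x ≤ ‖x - E.proj {t : ℝ | |t| < σ} x‖ :=
    ciInf_le (f := fun h : bandSubspace E σ => ‖x - (h : H)‖)
      ⟨0, by rintro _ ⟨h, rfl⟩; exact norm_nonneg _⟩
      ⟨E.proj {t : ℝ | |t| < σ} x, LinearMap.mem_range_self _ x⟩
  have h0 : 0 ≤ bestApprox E σ x := Real.iInf_nonneg fun _ => norm_nonneg _
  refine (pow_le_pow_left₀ h0 hle 2).trans_eq ?_
  have hin := congrArg Complex.re (E.inner_proj hB x)
  rw [Complex.ofReal_re] at hin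
  have hsub := norm_sub_sq (𝕜 := ℂ) x (E.proj {t : ℝ | |t| < σ} x)
  rw [RCLike.re_eq_complex_re, hin] at hsub
  rw [hBc, measureReal_compl hB, E.measureReal_univ, hsub, measureReal_def, E.measure_apply x hB,
    ENNReal.toReal_ofReal (sq_nonneg _)]
  ring

end Spectral

/-! ### Means with respect to a weight -/

/-- Jensen's inequality for the power function and the probability density `V`. -/
theorem IsWeight.integral_mul_rpow_le {V D : ℝ → ℝ} (hV : IsWeight V) (hVc : Continuous V)
    (hD : Continuous D) (hD0 : ∀ u, 0 ≤ D u) {r : ℝ} (hr : 1 ≤ r) :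
    (∫ u in (0 : ℝ)..1, D u * V u) ^ r ≤ ∫ u in (0 : ℝ)..1, D u ^ r * V u := by
  set a := ∫ u in (0 : ℝ)..1, D u * V u with ha
  have hDr : Continuous fun u => D u ^ r := hD.rpow_const fun _ => Or.inr (by linarith)
  have ha0 : 0 ≤ a := intervalIntegral.integral_nonneg zero_le_one
    fun u hu => mul_nonneg (hD0 u) (hV.nonneg u hu)
  rcases ha0.eq_or_lt with h0 | hpos
  · rw [← h0, Real.zero_rpow (by linarith)]
    exact intervalIntegral.integral_nonneg zero_le_one
      fun u hu => mul_nonneg (Real.rpow_nonneg (hD0 u) r) (hV.nonneg u hu)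
  -- the convex function `y ↦ y ^ r` lies above its tangent at the mean `a`
  have htangent : ∀ u, a ^ r * (1 - r) + a ^ r * r * a⁻¹ * D u ≤ D u ^ r := by
    intro u
    have hb := one_add_mul_self_le_rpow_one_add (s := D u / a - 1)
      (by linarith [div_nonneg (hD0 u) ha0]) hr
    rw [add_sub_cancel, Real.div_rpow (hD0 u) ha0, le_div_iff₀ (by positivity)] at hb
    refine le_trans (le_of_eq ?_) hb
    field_simp
    ring
  have hDV : Continuous fun u => D u * V u := hD.mul hVc
  have hDrV : Continuous fun u => D u ^ r * V u := hDr.mul hVc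
  calc a ^ r = ∫ u in (0 : ℝ)..1, (a ^ r * (1 - r) * V u + a ^ r * r * a⁻¹ * (D u * V u)) := by
        rw [intervalIntegral.integral_add ((hVc.const_mul _).intervalIntegrable _ _)
          ((hDV.const_mul _).intervalIntegrable _ _), intervalIntegral.integral_const_mul,
          intervalIntegral.integral_const_mul, hV.integral_eq_one, ← ha]
        field_simp
        ring
    _ ≤ ∫ u in (0 : ℝ)..1, D u ^ r * V u := by
        refine intervalIntegral.integral_mono_on zero_le_one
          (((hVc.const_mul _).add (hDV.const_mul _)).intervalIntegrable _ _)
          (hDrV.intervalIntegrable _ _) fun u hu => ?_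
        have := mul_le_mul_of_nonneg_right (htangent u) (hV.nonneg u hu)
        linarith

theorem IsWeight.integral_mul_le {V D : ℝ → ℝ} (hV : IsWeight V) (hVc : Continuous V)
    (hD : Continuous D) {C : ℝ} (hC : ∀ u ∈ Icc (0 : ℝ) 1, D u ≤ C) :
    ∫ u in (0 : ℝ)..1, D u * V u ≤ C := by
  have h : ∫ u in (0 : ℝ)..1, D u * V u ≤ ∫ u in (0 : ℝ)..1, C * V u :=
    intervalIntegral.integral_mono_on zero_le_one ((hD.mul hVc).intervalIntegrable _ _)
      ((hVc.const_mul C).intervalIntegrable _ _)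
      fun u hu => mul_le_mul_of_nonneg_right (hC u hu) (hV.nonneg u hu)
  rwa [intervalIntegral.integral_const_mul, hV.integral_eq_one, mul_one] at h

/-! ### The Jackson–Stechkin estimate -/

section Estimate

variable {H : Type*} [NormedAddCommGroup H] [InnerProductSpace ℂ H] [CompleteSpace H]

/-- If `Γ(V; δt) ≥ 𝓘(ψ)` for `|t| ≥ σ`, integrate this against the spectral measure over
`|t| ≥ σ` and exchange the integrals. -/
theorem meanValue_mul_bestApprox_sq_le {φ : ℂ → ℂ} (hφ : Continuous φ) {V : ℝ → ℝ}
    (hV : IsWeight V) (hVc : Continuous V) (E : ResolutionOfIdentity H) (x : H) {δ σ : ℝ}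
    (hpos : 0 ≤ meanValue (psiOf φ))
    (h : ∀ t, σ ≤ |t| → meanValue (psiOf φ) ≤ Gam (psiOf φ) V (δ * t)) :
    meanValue (psiOf φ) * bestApprox E σ x ^ 2 ≤
      ∫ u in (0 : ℝ)..1, ‖genDiff φ E (δ * u) x‖ ^ 2 * V u := by
  obtain ⟨M, hM⟩ := exists_psiOf_le hφ
  have hc := continuous_psiOf hφ
  set μ := E.measure x
  set ν : Measure ℝ := volume.restrict (Ioc 0 1)
  have hint : Integrable (Function.uncurry fun s u => psiOf φ (δ * s * u) * V u) (μ.prod ν) := by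
    have hVint : Integrable (fun p : ℝ × ℝ => V p.2) (μ.prod ν) :=
      Integrable.comp_snd (hVc.integrableOn_Ioc) μ
    refine hVint.bdd_mul (c := M) (f := fun p : ℝ × ℝ => psiOf φ (δ * p.1 * p.2))
      (Continuous.aestronglyMeasurable (by fun_prop)) (Eventually.of_forall fun p => ?_)
    rw [Real.norm_of_nonneg (psiOf_nonneg φ _)]
    exact hM _
  have hGint : Integrable (fun s => Gam (psiOf φ) V (δ * s)) μ := by
    simpa only [Gam, intervalIntegral.integral_of_le zero_le_one, Function.uncurry_apply_pair]
      using hint.integral_prod_left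
  have hGnonneg : ∀ s, 0 ≤ Gam (psiOf φ) V (δ * s) := fun s =>
    intervalIntegral.integral_nonneg zero_le_one
      fun u hu => mul_nonneg (psiOf_nonneg φ _) (hV.nonneg u hu)
  have hset : MeasurableSet {s : ℝ | σ ≤ |s|} :=
    measurableSet_le measurable_const continuous_abs.measurable
  calc meanValue (psiOf φ) * bestApprox E σ x ^ 2
      ≤ meanValue (psiOf φ) * μ.real {s | σ ≤ |s|} :=
        mul_le_mul_of_nonneg_left (bestApprox_sq_le E σ x) hpos
    _ = ∫ _ in {s | σ ≤ |s|}, meanValue (psiOf φ) ∂μ := by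
        rw [setIntegral_const, smul_eq_mul, mul_comm]
    _ ≤ ∫ s in {s | σ ≤ |s|}, Gam (psiOf φ) V (δ * s) ∂μ :=
        setIntegral_mono_on (integrable_const _) hGint.integrableOn hset h
    _ ≤ ∫ s, Gam (psiOf φ) V (δ * s) ∂μ :=
        setIntegral_le_integral hGint (Eventually.of_forall hGnonneg)
    _ = ∫ u in (0 : ℝ)..1, ‖genDiff φ E (δ * u) x‖ ^ 2 * V u := by
        simp only [Gam, intervalIntegral.integral_of_le zero_le_one]
        rw [integral_integral_swap hint]
        refine integral_congr_ae (Eventually.of_forall fun u => ?_)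
        simp only [norm_sq_genDiff hφ, integral_mul_const, mul_right_comm δ _ u, μ]

theorem modulus_nonneg (φ : ℂ → ℂ) (E : ResolutionOfIdentity H) (x : H) (δ : ℝ) :
    0 ≤ modulus φ E x δ :=
  Real.iSup_nonneg fun _ => norm_nonneg _

/-- The quadratic mean of the generalized differences is at most `ω_φ(x, δ)`. -/
theorem integral_sq_genDiff_le_modulus {φ : ℂ → ℂ} (hφ : Continuous φ) {V : ℝ → ℝ}
    (hV : IsWeight V) (hVc : Continuous V) (E : ResolutionOfIdentity H) (x : H) {δ : ℝ}
    (hδ : 0 < δ) :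
    ∫ u in (0 : ℝ)..1, ‖genDiff φ E (δ * u) x‖ ^ 2 * V u ≤ modulus φ E x δ ^ 2 := by
  have hD := ((continuous_norm_genDiff hφ E x).comp (continuous_const_mul δ)).pow 2
  refine hV.integral_mul_le hVc hD fun u hu =>
    pow_le_pow_left₀ (norm_nonneg _) (norm_genDiff_le_modulus hφ E x ⟨?_, ?_⟩) 2
  · exact mul_nonneg hδ.le hu.1
  · exact mul_le_of_le_one_right hδ.le hu.2

theorem modulusLp_nonneg (φ : ℂ → ℂ) {V : ℝ → ℝ} (hV : IsWeight V) (E : ResolutionOfIdentity H)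
    (x : H) (p : ℝ≥0∞) {δ : ℝ} (hδ : 0 < δ) : 0 ≤ modulusLp φ E x p V δ := by
  rw [modulusLp]
  split_ifs
  · exact modulus_nonneg φ E x δ
  · refine Real.rpow_nonneg (mul_nonneg (by positivity)
      (intervalIntegral.integral_nonneg hδ.le fun t ht => ?_)) _
    exact mul_nonneg (by positivity)
      (hV.nonneg _ ⟨div_nonneg ht.1 hδ.le, div_le_one_of_le₀ ht.2 hδ.le⟩)

/-- The quadratic mean of the generalized differences is at most their mean of order `p ≥ 2`. -/
theorem integral_sq_genDiff_le_modulusLp {φ : ℂ → ℂ} (hφ : Continuous φ) {V : ℝ → ℝ}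
    (hV : IsWeight V) (hVc : Continuous V) (E : ResolutionOfIdentity H) (x : H) {p : ℝ≥0∞}
    (hp : 2 ≤ p) {δ : ℝ} (hδ : 0 < δ) :
    ∫ u in (0 : ℝ)..1, ‖genDiff φ E (δ * u) x‖ ^ 2 * V u ≤ modulusLp φ E x p V δ ^ 2 := by
  by_cases htop : p = ∞
  · rw [modulusLp, if_pos htop]
    exact integral_sq_genDiff_le_modulus hφ hV hVc E x hδ
  have hq : 2 ≤ p.toReal := by simpa using ENNReal.toReal_mono htop hp
  set q := p.toReal
  have hscale : 1 / δ * ∫ t in (0 : ℝ)..δ, ‖genDiff φ E t x‖ ^ q * V (t / δ) =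
      ∫ u in (0 : ℝ)..1, ‖genDiff φ E (δ * u) x‖ ^ q * V u := by
    have hs := intervalIntegral.integral_comp_div (a := 0) (b := δ)
      (fun u => ‖genDiff φ E (δ * u) x‖ ^ q * V u) hδ.ne'
    simp only [mul_div_cancel₀ _ hδ.ne', zero_div, div_self hδ.ne', smul_eq_mul] at hs
    rw [hs, one_div, inv_mul_cancel_left₀ hδ.ne']
  have hD : Continuous fun u => ‖genDiff φ E (δ * u) x‖ ^ 2 :=
    ((continuous_norm_genDiff hφ E x).comp (continuous_const_mul δ)).pow 2
  have hJ := hV.integral_mul_rpow_le hVc hD (fun u => sq_nonneg _) (r := q / 2) (by linarith)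
  have hpow : ∀ u, (‖genDiff φ E (δ * u) x‖ ^ 2) ^ (q / 2) = ‖genDiff φ E (δ * u) x‖ ^ q := by
    intro u
    rw [← Real.rpow_natCast, ← Real.rpow_mul (norm_nonneg _)]
    congr 1
    push_cast
    ring
  simp only [hpow] at hJ
  have hA0 : 0 ≤ ∫ u in (0 : ℝ)..1, ‖genDiff φ E (δ * u) x‖ ^ 2 * V u :=
    intervalIntegral.integral_nonneg zero_le_one
      fun u hu => mul_nonneg (sq_nonneg _) (hV.nonneg u hu)
  have hroot := Real.rpow_le_rpow (by positivity) hJ (by positivity : 0 ≤ 2 / q)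
  rw [← Real.rpow_mul hA0, show q / 2 * (2 / q) = 1 by field_simp, Real.rpow_one] at hroot
  refine hroot.trans_eq ?_
  have hB0 : 0 ≤ ∫ u in (0 : ℝ)..1, ‖genDiff φ E (δ * u) x‖ ^ q * V u :=
    intervalIntegral.integral_nonneg zero_le_one
      fun u hu => mul_nonneg (by positivity) (hV.nonneg u hu)
  rw [modulusLp, if_neg htop, hscale, ← Real.rpow_natCast, ← Real.rpow_mul hB0]
  congr 1
  push_cast
  ring

theorem bestApprox_le_of_mul_sq_le (E : ResolutionOfIdentity H) (x : H) {I σ A ω : ℝ} (hI : 0 < I)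
    (hω : 0 ≤ ω) (h1 : I * bestApprox E σ x ^ 2 ≤ A) (h2 : A ≤ ω ^ 2) :
    bestApprox E σ x ≤ 1 / √I * ω := by
  have hs := Real.sqrt_pos.mpr hI
  rw [one_div, le_inv_mul_iff₀ hs]
  refine le_of_pow_le_pow_left₀ two_ne_zero hω ?_
  rw [mul_pow, Real.sq_sqrt hI.le]
  exact h1.trans h2

end Estimate

end JacksonStechkin

theorem mainTheorem3 (φ : ℂ → ℂ) (hφ : Continuous φ)
    (hψ : JacksonStechkin.IsPhi (JacksonStechkin.psiOf φ)) :
    ∃ γ : ℝ, 0 < γ ∧ ∃ V : ℝ → ℝ, JacksonStechkin.IsWeight V ∧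
      (∀ σ : ℝ, 0 < σ →
        JacksonStechkin.meanValue (JacksonStechkin.psiOf φ) ≤
          JacksonStechkin.lowerGam (JacksonStechkin.psiOf φ) V (γ / σ) σ) ∧
      ∀ (H : Type*) [NormedAddCommGroup H] [InnerProductSpace ℂ H] [CompleteSpace H]
        (E : JacksonStechkin.ResolutionOfIdentity H) (x : H) (σ : ℝ), 0 < σ →
        (∀ p : ℝ≥0∞, 2 ≤ p →
          JacksonStechkin.bestApprox E σ x ≤
            1 / √(JacksonStechkin.meanValue (JacksonStechkin.psiOf φ)) *
              JacksonStechkin.modulusLp φ E x p V (γ / σ)) ∧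
        JacksonStechkin.bestApprox E σ x ≤
          1 / √(JacksonStechkin.meanValue (JacksonStechkin.psiOf φ)) *
            JacksonStechkin.modulus φ E x (γ / σ) := by
  obtain ⟨γ, hγ, V, hVc, hV, hΓ⟩ := hψ.exists_weight
  have hI := hψ.meanValue_pos
  have hΓσ : ∀ σ : ℝ, 0 < σ → ∀ t, σ ≤ |t| →
      JacksonStechkin.meanValue (JacksonStechkin.psiOf φ) ≤
        JacksonStechkin.Gam (JacksonStechkin.psiOf φ) V (γ / σ * t) := by
    intro σ hσ t ht
    refine hΓ _ ?_
    rw [abs_mul, abs_of_pos (div_pos hγ hσ), div_mul_eq_mul_div, le_div_iff₀ hσ]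
    exact mul_le_mul_of_nonneg_left ht hγ.le
  refine ⟨γ, hγ, V, hV, fun σ hσ => ?_, fun H _ _ _ E x σ hσ => ?_⟩
  · have : Nonempty {t : ℝ // σ ≤ |t|} := ⟨⟨σ, le_abs_self σ⟩⟩
    exact le_ciInf fun t => hΓσ σ hσ t t.2
  · have hδ := div_pos hγ hσ
    have hmain := JacksonStechkin.meanValue_mul_bestApprox_sq_le hφ hV hVc E x hI.le (hΓσ σ hσ)
    exact ⟨fun p hp => JacksonStechkin.bestApprox_le_of_mul_sq_le E x hI
        (JacksonStechkin.modulusLp_nonneg φ hV E x p hδ) hmain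
        (JacksonStechkin.integral_sq_genDiff_le_modulusLp hφ hV hVc E x hp hδ),
      JacksonStechkin.bestApprox_le_of_mul_sq_le E x hI (JacksonStechkin.modulus_nonneg φ E x _)
        hmain (JacksonStechkin.integral_sq_genDiff_le_modulus hφ hV hVc E x hδ)⟩
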